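/- All graphs are finite, connected, undirected, without loops or multiple edges. A graph is cubic if it is regular of valency $3$, and vertex-transitive if its automorphism group acts transitively on its vertices. An automorphism $g$ of a graph is semiregular if the identity is the only element of $\langle g\rangle$ that fixes a vertex. **Theorem.** (1) There is no function $f:\mathbb{N}\to\mathbb{N}$ with $\lim_{n\to\infty}f(n)=\infty$ such that every cubic vertex-transitive graph with $n$ vertices has a semiregular automorphism of order at least $f(n)$. (2) Moreover, for every integer $m\geq 1$ there is a cubic vertex-transitive graph $\Gamma$ with exactly $2^{m+1}\cdot 3^{2^m+1}$ vertices such that $\mathrm{Aut}(\Gamma)\cong V\rtimes Q$, where $V$ is an extraspecial $3$-group of order $3^{2^m+1}$ and exponent $3$ and $Q$ is a dihedral group of order $2^{m+2}$, and such that every semiregular automorphism of $\Gamma$ has order $1$, $2$, $3$ or $6$. (A finite $3$-group is extraspecial if its centre has order $3$ and the quotient by its centre is a non-trivial elementary abelian $3$-group.) -/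

import Mathlib

open Filter

/-- A connected cubic vertex-transitive graph: connected (in particular non-empty), every vertex has
exactly three neighbours, and the automorphism group is transitive on the vertices.
Finiteness of the vertex set is assumed separately where the notion is used. -/
structure SimpleGraph.IsCubicVertexTransitive {Ω : Type*} (Γ : SimpleGraph Ω) : Prop where
  connected : Γ.Connected
  cubic : ∀ v : Ω, (Γ.neighborSet v).ncard = 3
  transitive : ∀ u v : Ω, ∃ g : Γ ≃g Γ, g u = v

/-- An automorphism `g` of a graph is semiregular if the identity is the only element of the cyclic
group generated by `g` that fixes some vertex. -/
def SimpleGraph.IsSemiregularAut {Ω : Type*} {Γ : SimpleGraph Ω} (g : Γ ≃g Γ) : Prop :=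
  ∀ h ∈ Subgroup.zpowers g, (∃ v : Ω, h v = v) → h = 1

/-- A finite `p`-group is extraspecial if its centre has order `p` and the quotient by the centre
is a non-trivial elementary abelian `p`-group. -/
structure IsExtraspecialGroup (p : ℕ) (V : Type*) [Group V] : Prop where
  prime : p.Prime
  finite : Finite V
  isPGroup : IsPGroup p V
  card_center : Nat.card (Subgroup.center V) = p
  nontrivial_quotient : Nontrivial (V ⧸ Subgroup.center V)
  quotient_comm : ∀ x y : V ⧸ Subgroup.center V, x * y = y * x
  quotient_pow : ∀ x : V ⧸ Subgroup.center V, x ^ p = 1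

/-!
Let `N = 2 ^ m` and let `W = Antiperiodic N` be the `N`-dimensional space of functions on `ℤ/2N`
over `𝔽₃` with `f (j + N) = -f j`. It has the spanning vectors `e k` with `e (k + N) = -e k`, and
an alternating form which is nondegenerate because `N` is even; so the Heisenberg group
`V = W × 𝔽₃` is extraspecial of exponent `3`. The dihedral group `Q` of order `4N` acts on `ℤ/2N`, hence on
`V`; reflections invert the centre, and the half turn `r N` acts as `-1` on `W`.

The graph `hexGraph N` has an upper and a lower vertex `(x, i)` for each `x ∈ V` and `i ∈ ℤ/N`. The
upper `(x, i)` is adjacent to the lower `(x, i + 1)` and to the lower `(x (± e i, 1), i)`; the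
edges of the second kind form hexagons. The group `V ⋊ Q` acts transitively on the vertices, and
the stabiliser of `(1, 0)` is generated by the half turn.

The main point is that there are no other automorphisms (`toAut_surjective`). The edges between
different hexagons are exactly those on no non-backtracking closed walk of length `6`
(`onHexagon_ray`, `not_onHexagon`), so an automorphism `α` fixing a vertex preserves positions and
sides (`map_idx_up`) and induces on `V` one map for each position. Since `α` respects antipodes on
the hexagons, going down one position commutes with multiplication by the central element `(0, 1)`.
Going `N` times around the cycle and using `3 ∤ N`, one sees that the induced maps commute with the
centre and are all the same map `β` (`ptMap_mul_central`, `ptMap_eq`). This `β` maps `x (t e k, 0)`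
to `β x (± t e k, 0)`; commutator relations in `V` force all the signs to agree (`eq_scale`), so
`α` is the identity or the half turn.

For the orders, let `g = (v, q)`. If `q² = 1` then `g⁶ = 1`. Otherwise some power of `q` is the
half turn, and the cube of the corresponding power of `g` is a nontrivial automorphism with a fixed
vertex (`exists_half_turn_pow_three_smul_eq`), so `g` is not semiregular. The nonexistence of `f`
follows, as the number of vertices is unbounded.
-/

/-! ### Antiperiodic functions and their alternating form -/

/-- The functions `f : ℤ/2N → 𝔽₃` with `f (j + N) = -f j`, a space of dimension `N` over `𝔽₃`. -/
def Antiperiodic (N : ℕ) : Submodule (ZMod 3) (ZMod (2 * N) → ZMod 3) where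
  carrier := {f | ∀ j, f (j + N) = -f j}
  add_mem' {f g} hf hg j := by
    simp only [Pi.add_apply, hf j, hg j]
    ring
  zero_mem' j := by simp
  smul_mem' c f hf j := by simp [hf j]

namespace Antiperiodic

variable {N : ℕ}

instance : CoeFun (Antiperiodic N) fun _ => ZMod (2 * N) → ZMod 3 := ⟨fun f => f.1⟩

@[ext]
theorem ext {f g : Antiperiodic N} (h : ∀ j, f j = g j) : f = g :=
  Subtype.ext (funext h)

@[simp] theorem add_apply (f g : Antiperiodic N) (j : ZMod (2 * N)) : (f + g) j = f j + g j := rfl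
@[simp] theorem neg_apply (f : Antiperiodic N) (j : ZMod (2 * N)) : (-f) j = -f j := rfl
@[simp] theorem zero_apply (j : ZMod (2 * N)) : (0 : Antiperiodic N) j = 0 := rfl
@[simp] theorem smul_apply (t : ZMod 3) (f : Antiperiodic N) (j : ZMod (2 * N)) :
    (t • f) j = t * f j := rfl

theorem apply_add (f : Antiperiodic N) (j : ZMod (2 * N)) : f (j + (N : ZMod (2 * N))) = -f j :=
  f.2 j

theorem half_add_half : (N : ZMod (2 * N)) + N = 0 := by
  have := ZMod.natCast_self (2 * N)
  push_cast at this
  rw [← this]; ring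

theorem half_ne_zero [NeZero N] : (N : ZMod (2 * N)) ≠ 0 := by
  rw [Ne, ZMod.natCast_eq_zero_iff]
  intro h
  have := Nat.le_of_dvd (NeZero.pos N) h
  have := NeZero.pos N
  omega

/-- The generator `e k = δ_k - δ_{k+N}`; thus `e (k + N) = -e k`. -/
def e [NeZero N] (k : ZMod (2 * N)) : Antiperiodic N where
  val j := (if j = k then 1 else 0) - (if j = k + N then 1 else 0)
  property j := by
    have h : j + (N : ZMod (2 * N)) = k ↔ j = k + (N : ZMod (2 * N)) :=
      ⟨fun h => by rw [← h, add_assoc, half_add_half, add_zero],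
        fun h => by rw [h, add_assoc, half_add_half, add_zero]⟩
    simp only [add_left_inj, h]
    ring

theorem e_apply [NeZero N] (k j : ZMod (2 * N)) :
    e k j = (if j = k then 1 else 0) - (if j = k + N then 1 else 0) := rfl

theorem e_self [NeZero N] (k : ZMod (2 * N)) : e k k = 1 := by
  simp [e_apply, half_ne_zero]

theorem e_add_half [NeZero N] (k : ZMod (2 * N)) :
    e (k + (N : ZMod (2 * N))) = -e k := by
  ext j
  rw [e_apply, neg_apply, e_apply, add_assoc, half_add_half, add_zero]
  ring

theorem e_apply_of_ne [NeZero N] {k j : ZMod (2 * N)} (h : j ≠ k) (h' : j ≠ k + N) :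
    e k j = 0 := by
  simp [e_apply, h, h']

theorem e_ne_zero [NeZero N] (k : ZMod (2 * N)) : e k ≠ 0 := fun h => by
  have := e_self k
  rw [h] at this
  simp at this

/-- Summed over all `2N` indices, the functions `f k • e k` give `2f = -f`. -/
theorem neg_sum_smul_e [NeZero N] (f : Antiperiodic N) : -∑ k, f k • e k = f := by
  ext j
  have h : (∑ k, f k • e k : Antiperiodic N) j = ∑ k, f k * e k j := by
    simp
  rw [neg_apply, h]
  have h2 : ∀ k, j = k + N ↔ k = j + N := fun k =>
    ⟨fun h => by rw [h, add_assoc, half_add_half, add_zero],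
      fun h => by rw [h, add_assoc, half_add_half, add_zero]⟩
  simp only [e_apply, mul_sub, mul_ite, mul_one, mul_zero, Finset.sum_sub_distrib, h2,
    Finset.sum_ite_eq, Finset.sum_ite_eq', Finset.mem_univ, if_true, apply_add]
  generalize f j = t
  revert t; decide

/-- An antiperiodic function is given freely by its values on the residues of `0, …, N - 1`. -/
theorem natCard [NeZero N] : Nat.card (Antiperiodic N) = 3 ^ N := by
  have hN := NeZero.pos N
  have hcast : ∀ i : Fin N, ((i : ℕ) : ZMod (2 * N)).val = i := fun i =>
    ZMod.val_cast_of_lt (by omega)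
  have hadd : ∀ j : ZMod (2 * N), j.val < N → (j + N).val = j.val + N := by
    intro j hj
    rw [ZMod.val_add, ZMod.val_cast_of_lt (by omega : N < 2 * N), Nat.mod_eq_of_lt (by omega)]
  have hadd' : ∀ j : ZMod (2 * N), ¬ j.val < N → (j + N).val = j.val - N := by
    intro j hj
    have := ZMod.val_lt j
    rw [ZMod.val_add, ZMod.val_cast_of_lt (by omega : N < 2 * N),
      Nat.mod_eq_sub_mod (by omega), Nat.mod_eq_of_lt (by omega)]
    omega
  have hb : Function.Bijective
      (fun (f : Antiperiodic N) (i : Fin N) => f ((i : ℕ) : ZMod (2 * N))) := by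
    constructor
    · intro f g h
      have key : ∀ j : ZMod (2 * N), j.val < N → f j = g j := by
        intro j hj
        have := congrFun h ⟨j.val, hj⟩
        simpa using this
      ext j
      by_cases hj : j.val < N
      · exact key j hj
      · have := key (j + N) (by rw [hadd' j hj]; have := ZMod.val_lt j; omega)
        rw [apply_add, apply_add] at this
        exact neg_injective this
    · intro g
      refine ⟨⟨fun j => if h : j.val < N then g ⟨j.val, h⟩ else -g ⟨j.val - N, by
        have := ZMod.val_lt j; omega⟩, ?_⟩, ?_⟩
      · intro j
        by_cases hj : j.val < N
        · simp only [hj, dite_true, hadd j hj, Nat.add_sub_cancel]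
          rw [dif_neg (by omega)]
        · simp only [hj, dite_false, hadd' j hj, neg_neg]
          rw [dif_pos (by have := ZMod.val_lt j; omega)]
      · funext i
        simp only [hcast, i.2, dite_true]
  rw [Nat.card_eq_of_bijective _ hb]
  simp

/-- The alternating form `B(f, g) = ∑ j, (f j * g (j+1) - f (j+1) * g j)`. -/
def form [NeZero N] (f g : Antiperiodic N) : ZMod 3 :=
  ∑ j, (f j * g (j + 1) - f (j + 1) * g j)

section form

variable [NeZero N]

theorem form_add_left (f f' g : Antiperiodic N) : form (f + f') g = form f g + form f' g := by
  rw [form, form, form, ← Finset.sum_add_distrib]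
  exact Finset.sum_congr rfl fun j _ => by simp only [add_apply]; ring

theorem form_swap (f g : Antiperiodic N) : form g f = -form f g := by
  rw [form, form, ← Finset.sum_neg_distrib]
  exact Finset.sum_congr rfl fun j _ => by ring

theorem form_smul_left (t : ZMod 3) (f g : Antiperiodic N) : form (t • f) g = t * form f g := by
  rw [form, form, Finset.mul_sum]
  exact Finset.sum_congr rfl fun j _ => by simp only [smul_apply]; ring

theorem form_add_right (f g g' : Antiperiodic N) : form f (g + g') = form f g + form f g' := by
  rw [form_swap, form_add_left, form_swap f g, form_swap f g']
  ring

theorem form_smul_right (t : ZMod 3) (f g : Antiperiodic N) : form f (t • g) = t * form f g := by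
  rw [form_swap, form_smul_left, form_swap f g]; ring

@[simp] theorem form_self (f : Antiperiodic N) : form f f = 0 :=
  Finset.sum_eq_zero fun j _ => by ring

@[simp] theorem form_zero_left (f : Antiperiodic N) : form 0 f = 0 := by
  simpa using form_smul_left 0 0 f

@[simp] theorem form_zero_right (f : Antiperiodic N) : form f 0 = 0 := by
  simpa using form_smul_right 0 f 0

theorem form_neg_left (f g : Antiperiodic N) : form (-f) g = -form f g := by
  rw [← neg_one_smul (ZMod 3) f, form_smul_left, neg_one_mul]

theorem form_neg_right (f g : Antiperiodic N) : form f (-g) = -form f g := by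
  rw [← neg_one_smul (ZMod 3) g, form_smul_right, neg_one_mul]

theorem form_e (f : Antiperiodic N) (k : ZMod (2 * N)) : form f (e k) = f (k + 1) - f (k - 1) := by
  have h1 : ∀ j : ZMod (2 * N), j + 1 = k ↔ j = k - 1 := fun j => eq_sub_iff_add_eq.symm
  have h2 : ∀ j : ZMod (2 * N), j + 1 = k + N ↔ j = k - 1 + N := fun j =>
    ⟨fun h => by rw [← sub_eq_zero] at h ⊢; rw [← h]; ring,
     fun h => by rw [h]; ring⟩
  simp only [form, e_apply, mul_sub, mul_ite, mul_one, mul_zero, Finset.sum_sub_distrib,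
    h1, h2, Finset.sum_ite_eq', Finset.mem_univ, if_true, apply_add,
    add_right_comm k (N : ZMod (2 * N)) 1]
  generalize f (k + 1) = s
  generalize f (k - 1) = t
  revert s t; decide

/-- If `B(f, ·) = 0` then `f (j + 2) = f j` for all `j`; as `N` is even this gives
`f j = f (j + N) = -f j`. -/
theorem eq_zero_of_form_eq_zero (hN : Even N) (f : Antiperiodic N) (h : ∀ g, form f g = 0) :
    f = 0 := by
  have h2 : ∀ j, f (j + 2) = f j := fun j => by
    have := h (e (j + 1))
    rw [form_e, sub_eq_zero] at this
    rwa [add_sub_cancel_right, add_assoc, one_add_one_eq_two] at this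
  have h3 : ∀ (n : ℕ) j, f (j + (2 * n : ℕ)) = f j := by
    intro n
    induction n with
    | zero => simp
    | succ n ih =>
      intro j
      rw [← ih j, ← h2 (j + (2 * n : ℕ))]
      exact congrArg f.1 (by push_cast; ring)
  obtain ⟨n, hn⟩ := hN
  ext j
  have h4 := h3 n j
  rw [show 2 * n = N by omega, apply_add] at h4
  rw [zero_apply]
  generalize f j = t at h4
  revert t; decide

theorem form_e_succ_ne_zero (hN : 2 ≤ N) (k : ZMod (2 * N)) : form (e k) (e (k + 1)) ≠ 0 := by
  rw [form_e, add_sub_cancel_right, e_self]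
  have h : k + 1 + 1 ≠ k := by
    intro h
    have h2 : ((2 : ℕ) : ZMod (2 * N)) = 0 := by
      push_cast
      calc (2 : ZMod (2 * N)) = (k + 1 + 1) - k := by ring
        _ = 0 := by rw [h, sub_self]
    rw [ZMod.natCast_eq_zero_iff] at h2
    have := Nat.le_of_dvd (by norm_num) h2
    omega
  rw [e_apply, if_neg h]
  split_ifs <;> decide

end form

end Antiperiodic

/-! ### The extraspecial group -/

/-- The Heisenberg group `Antiperiodic N × 𝔽₃` of the form `Antiperiodic.form`, with
multiplication `(f, s) (g, t) = (f + g, s + t + B(f, g))`. -/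
@[ext]
structure Heisenberg (N : ℕ) where
  /-- the component modulo the centre -/
  vec : Antiperiodic N
  /-- the central component -/
  cen : ZMod 3

namespace Heisenberg

open Antiperiodic

variable {N : ℕ}

instance : One (Heisenberg N) := ⟨⟨0, 0⟩⟩
instance : Inv (Heisenberg N) := ⟨fun x => ⟨-x.vec, -x.cen⟩⟩

/-- The central element with central component `s`. -/
def central (s : ZMod 3) : Heisenberg N := ⟨0, s⟩

@[simp] theorem one_vec : (1 : Heisenberg N).vec = 0 := rfl
@[simp] theorem one_cen : (1 : Heisenberg N).cen = 0 := rfl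
@[simp] theorem inv_cen (x : Heisenberg N) : x⁻¹.cen = -x.cen := rfl
@[simp] theorem inv_vec (x : Heisenberg N) : x⁻¹.vec = -x.vec := rfl
@[simp] theorem central_vec (s : ZMod 3) : (central s : Heisenberg N).vec = 0 := rfl
@[simp] theorem central_cen (s : ZMod 3) : (central s : Heisenberg N).cen = s := rfl

theorem central_zero : (central 0 : Heisenberg N) = 1 := rfl

variable [NeZero N]

instance : Mul (Heisenberg N) := ⟨fun x y => ⟨x.vec + y.vec, x.cen + y.cen + form x.vec y.vec⟩⟩

@[simp] theorem mul_vec (x y : Heisenberg N) : (x * y).vec = x.vec + y.vec := rfl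
@[simp] theorem mul_cen (x y : Heisenberg N) :
    (x * y).cen = x.cen + y.cen + form x.vec y.vec := rfl

instance : Group (Heisenberg N) :=
  Group.ofLeftAxioms
    (fun x y z => Heisenberg.ext (add_assoc _ _ _) (by
      simp only [mul_cen, mul_vec, form_add_left, form_add_right]; ring))
    (fun x => Heisenberg.ext (zero_add _) (by simp))
    (fun x => Heisenberg.ext (neg_add_cancel _) (by
      change -x.cen + x.cen + form (-x.vec) x.vec = 0
      simp [form_neg_left]))

theorem natCard : Nat.card (Heisenberg N) = 3 ^ (N + 1) := by
  have : Heisenberg N ≃ Antiperiodic N × ZMod 3 :=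
    ⟨fun x => (x.vec, x.cen), fun p => ⟨p.1, p.2⟩, fun _ => rfl, fun _ => rfl⟩
  rw [Nat.card_congr this, Nat.card_prod, Antiperiodic.natCard, Nat.card_zmod, pow_succ]

instance : Finite (Heisenberg N) :=
  Nat.finite_of_card_ne_zero (by rw [natCard]; positivity)

theorem pow_three (x : Heisenberg N) : x ^ 3 = 1 := by
  have h : ∀ t : ZMod 3, t + t + t = 0 := by decide
  rw [pow_succ, sq]
  ext1
  · ext j
    simp [h]
  · simp [form_add_left, h]

theorem central_mul (x : Heisenberg N) (s : ZMod 3) : central s * x = x * central s := by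
  ext1
  · simp
  · simp [add_comm]

theorem central_mul_central (s t : ZMod 3) :
    (central s * central t : Heisenberg N) = central (s + t) := by
  ext1 <;> simp

theorem mem_center_iff (hN : Even N) (x : Heisenberg N) :
    x ∈ Subgroup.center (Heisenberg N) ↔ x.vec = 0 := by
  rw [Subgroup.mem_center_iff]
  constructor
  · intro h
    apply eq_zero_of_form_eq_zero hN
    intro g
    have := congrArg cen (h ⟨g, 0⟩)
    simp only [mul_cen, zero_add, add_zero, form_swap x.vec g] at this
    generalize x.cen = s at this
    generalize form x.vec g = t at this
    revert s t
    decide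
  · intro h g
    have : x = central x.cen := by ext1 <;> simp [h]
    rw [this, central_mul]

theorem isExtraspecialGroup (hN : Even N) : IsExtraspecialGroup 3 (Heisenberg N) where
  prime := Nat.prime_three
  finite := inferInstance
  isPGroup := IsPGroup.of_card natCard
  card_center := by
    have : Subgroup.center (Heisenberg N) ≃ ZMod 3 :=
      { toFun := fun x => x.1.cen
        invFun := fun s => ⟨central s, (mem_center_iff hN _).2 rfl⟩
        left_inv := fun x => Subtype.ext (Heisenberg.ext ((mem_center_iff hN _).1 x.2).symm rfl)
        right_inv := fun _ => rfl }
    rw [Nat.card_congr this, Nat.card_zmod]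
  nontrivial_quotient := by
    rw [← not_subsingleton_iff_nontrivial]
    intro h
    have h1 : ((⟨e 0, 0⟩ : Heisenberg N) : Heisenberg N ⧸ Subgroup.center (Heisenberg N)) = 1 :=
      Subsingleton.elim _ _
    rw [QuotientGroup.eq_one_iff, mem_center_iff hN] at h1
    exact e_ne_zero 0 h1
  quotient_comm := by
    intro x y
    induction x using QuotientGroup.induction_on with | _ x => ?_
    induction y using QuotientGroup.induction_on with | _ y => ?_
    rw [← QuotientGroup.mk_mul, ← QuotientGroup.mk_mul, QuotientGroup.eq, mem_center_iff hN]
    simp only [mul_vec, inv_vec]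
    abel
  quotient_pow := by
    intro x
    induction x using QuotientGroup.induction_on with | _ x => ?_
    rw [← QuotientGroup.mk_pow, pow_three, QuotientGroup.mk_one]

theorem exponent_eq_three : Monoid.exponent (Heisenberg N) = 3 := by
  have : Nontrivial (Heisenberg N) :=
    ⟨⟨central 1, 1, fun h => by simpa using congrArg cen h⟩⟩
  rw [Monoid.exponent_eq_prime_iff Nat.prime_three]
  exact fun g hg => orderOf_eq_prime (pow_three g) hg

/-- The elements `(e k, 0)` and the centre generate. -/
theorem eq_top_of_generators_mem (H : Subgroup (Heisenberg N)) (hc : ∀ s, central s ∈ H)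
    (he : ∀ k, ⟨e k, 0⟩ ∈ H) : H = ⊤ := by
  let A : AddSubgroup (Antiperiodic N) :=
    { carrier := {f | (⟨f, 0⟩ : Heisenberg N) ∈ H}
      zero_mem' := H.one_mem
      neg_mem' := fun {f} hf => by
        have : (⟨-f, 0⟩ : Heisenberg N) = ⟨f, 0⟩⁻¹ := by ext1 <;> simp
        simpa [this] using hf
      add_mem' := fun {f g} hf hg => by
        have : (⟨f + g, 0⟩ : Heisenberg N) = ⟨f, 0⟩ * ⟨g, 0⟩ * central (-form f g) := by
          ext1 <;> simp
        change (⟨f + g, 0⟩ : Heisenberg N) ∈ H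
        rw [this]
        exact H.mul_mem (H.mul_mem hf hg) (hc _) }
  have hA : ∀ f, f ∈ A := fun f => by
    rw [← neg_sum_smul_e f]
    refine A.neg_mem (A.sum_mem fun k _ => ?_)
    generalize f k = t
    have hk : e k ∈ A := he k
    have ht : t = 0 ∨ t = 1 ∨ t = -1 := by revert t; decide
    rcases ht with rfl | rfl | rfl
    · simp
    · rwa [one_smul]
    · have : (-1 : ZMod 3) • e k = -e k := by ext j; simp
      exact this ▸ A.neg_mem hk
  rw [eq_top_iff]
  intro x _
  have : x = ⟨x.vec, 0⟩ * central x.cen := by ext1 <;> simp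
  rw [this]
  exact H.mul_mem (hA x.vec) (hc _)

end Heisenberg

/-! ### The dihedral group acting on the extraspecial group -/

/-- The dihedral group of order `2n` acts on `ℤ/n`: `r k` is `j ↦ j + k` and `sr k` is
`j ↦ -(j + k)`. -/
instance DihedralGroup.mulActionZMod (n : ℕ) : MulAction (DihedralGroup n) (ZMod n) where
  smul
    | .r k, j => j + k
    | .sr k, j => -(j + k)
  one_smul j := add_zero j
  mul_smul g h j := by
    rcases g with a | a <;> rcases h with b | b
    · change j + (a + b) = j + b + a
      ring
    · change -(j + (b - a)) = -(j + b) + a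
      ring
    · change -(j + (a + b)) = -(j + b + a)
      ring
    · change j + (b - a) = -(-(j + b) + a)
      ring

namespace DihedralGroup

theorem r_smul {n : ℕ} (k j : ZMod n) : (r k : DihedralGroup n) • j = j + k := rfl
theorem sr_smul {n : ℕ} (k j : ZMod n) : (sr k : DihedralGroup n) • j = -(j + k) := rfl

/-- The sign character, `1` on rotations and `-1` on reflections, with values in `𝔽₃`. -/
def sign {n : ℕ} : DihedralGroup n →* ZMod 3 where
  toFun
    | .r _ => 1
    | .sr _ => -1
  map_one' := rfl
  map_mul' g h := by
    rcases g with a | a <;> rcases h with b | b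
    · exact (one_mul 1).symm
    · exact (one_mul (-1)).symm
    · exact (mul_one (-1)).symm
    · exact (by decide : (1 : ZMod 3) = -1 * -1)

@[simp] theorem sign_r {n : ℕ} (k : ZMod n) : sign (r k) = 1 := rfl
@[simp] theorem sign_sr {n : ℕ} (k : ZMod n) : sign (sr k) = -1 := rfl

end DihedralGroup

open DihedralGroup

namespace Antiperiodic

variable {N : ℕ}

theorem smul_add_half (g : DihedralGroup (2 * N)) (j : ZMod (2 * N)) :
    g • (j + (N : ZMod (2 * N))) = g • j + (N : ZMod (2 * N)) := by
  rcases g with k | k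
  · simp only [r_smul]
    ring
  · simp only [sr_smul]
    rw [← sub_eq_zero]
    calc _ = -((N : ZMod (2 * N)) + N) := by ring
      _ = 0 := by rw [half_add_half, neg_zero]

instance : SMul (DihedralGroup (2 * N)) (Antiperiodic N) where
  smul g f := ⟨fun j => f (g⁻¹ • j), fun j => by
    change f (g⁻¹ • (j + (N : ZMod (2 * N)))) = _
    rw [smul_add_half, apply_add]⟩

theorem dihedral_smul_apply (g : DihedralGroup (2 * N)) (f : Antiperiodic N) (j : ZMod (2 * N)) :
    (g • f) j = f (g⁻¹ • j) := rfl

instance : DistribMulAction (DihedralGroup (2 * N)) (Antiperiodic N) where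
  one_smul f := ext fun j => by rw [dihedral_smul_apply, inv_one, one_smul]
  mul_smul g h f := ext fun j => by
    simp only [dihedral_smul_apply, mul_inv_rev, mul_smul]
  smul_zero _ := rfl
  smul_add _ _ _ := rfl

theorem half_turn_smul_vec (f : Antiperiodic N) :
    (r (N : ZMod (2 * N)) : DihedralGroup (2 * N)) • f = -f := by
  ext j
  have : (r (N : ZMod (2 * N)) : DihedralGroup (2 * N))⁻¹ • j = j + -(N : ZMod (2 * N)) := rfl
  rw [dihedral_smul_apply, this, neg_eq_of_add_eq_zero_left half_add_half, apply_add, neg_apply]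

variable [NeZero N]

theorem dihedral_smul_e (g : DihedralGroup (2 * N)) (k : ZMod (2 * N)) : g • e k = e (g • k) := by
  ext j
  rw [dihedral_smul_apply, e_apply, e_apply, ← smul_add_half]
  simp only [inv_smul_eq_iff]

/-- The form is invariant under rotations and changes its sign under reflections. -/
theorem form_dihedral_smul (g : DihedralGroup (2 * N)) (f f' : Antiperiodic N) :
    form (g • f) (g • f') = sign g * form f f' := by
  rcases g with k | k
  · rw [sign_r, one_mul, form, form]
    refine Fintype.sum_equiv (Equiv.addRight (-k)) _ _ fun j => ?_
    have h : ∀ j : ZMod (2 * N), (r k : DihedralGroup (2 * N))⁻¹ • j = j + -k := fun _ => rfl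
    simp only [dihedral_smul_apply, h, Equiv.coe_addRight, add_right_comm j 1 (-k)]
  · rw [sign_sr, neg_one_mul, form, form, ← Finset.sum_neg_distrib]
    refine Fintype.sum_equiv (Equiv.subLeft (-k - 1)) _ _ fun j => ?_
    have h : ∀ j : ZMod (2 * N), (sr k : DihedralGroup (2 * N))⁻¹ • j = -(j + k) := fun _ => rfl
    have h1 : -(j + k) = -k - 1 - j + 1 := by ring
    have h2 : -(j + 1 + k) = -k - 1 - j := by ring
    simp only [dihedral_smul_apply, h, Equiv.subLeft_apply, h1, h2]
    ring

end Antiperiodic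

namespace Heisenberg

open Antiperiodic

variable {N : ℕ}

instance : SMul (DihedralGroup (2 * N)) (Heisenberg N) := ⟨fun g x => ⟨g • x.vec, sign g * x.cen⟩⟩

@[simp] theorem dihedral_smul_vec (g : DihedralGroup (2 * N)) (x : Heisenberg N) :
    (g • x).vec = g • x.vec := rfl
@[simp] theorem dihedral_smul_cen (g : DihedralGroup (2 * N)) (x : Heisenberg N) :
    (g • x).cen = sign g * x.cen := rfl

variable [NeZero N]

instance : MulDistribMulAction (DihedralGroup (2 * N)) (Heisenberg N) where
  one_smul x := by ext1 <;> simp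
  mul_smul g h x := by ext1 <;> simp [mul_smul, mul_assoc]
  smul_one g := by ext1 <;> simp
  smul_mul g x y := by
    ext1
    · simp
    · simp only [dihedral_smul_cen, mul_cen, dihedral_smul_vec, form_dihedral_smul]
      ring

theorem dihedral_smul_mk_e (g : DihedralGroup (2 * N)) (k : ZMod (2 * N)) (s : ZMod 3) :
    g • (⟨e k, s⟩ : Heisenberg N) = ⟨e (g • k), sign g * s⟩ :=
  Heisenberg.ext (dihedral_smul_e g k) rfl

end Heisenberg

/-- The action of the dihedral group of order `4N` on the Heisenberg group. -/
abbrev dihedralTwist (N : ℕ) [NeZero N] : DihedralGroup (2 * N) →* MulAut (Heisenberg N) :=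
  MulDistribMulAction.toMulAut (DihedralGroup (2 * N)) (Heisenberg N)

/-! ### The graph -/

/-- Vertices: a group element, a position on a cycle of length `N`, and a side. -/
@[ext]
structure HexVertex (N : ℕ) where
  /-- the group element -/
  pt : Heisenberg N
  /-- the position on the cycle -/
  idx : ZMod N
  /-- the side, `true` for the upper and `false` for the lower one -/
  up : Bool

namespace HexVertex

open Antiperiodic Heisenberg

variable {N : ℕ}

/-- Reduction modulo `N` of the indices modulo `2N`. -/
def proj (N : ℕ) : ZMod (2 * N) →+* ZMod N := ZMod.castHom (dvd_mul_left N 2) (ZMod N)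

theorem proj_half : proj N (N : ZMod (2 * N)) = 0 := by simp

theorem proj_surjective : Function.Surjective (proj N) := ZMod.castHom_surjective _

theorem proj_eq_iff [NeZero N] {k l : ZMod (2 * N)} :
    proj N k = proj N l ↔ k = l ∨ k = l + (N : ZMod (2 * N)) := by
  constructor
  · intro h
    have h0 : proj N (k - l) = 0 := by rw [map_sub, h, sub_self]
    have h1 : ((k - l).val : ZMod (2 * N)) = k - l := ZMod.natCast_zmod_val _
    rw [← h1, map_natCast, ZMod.natCast_eq_zero_iff] at h0
    obtain ⟨c, hc⟩ := h0
    have hlt := ZMod.val_lt (k - l)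
    rw [hc, mul_comm N c] at hlt
    have hc2 : c < 2 := lt_of_mul_lt_mul_right hlt (Nat.zero_le N)
    interval_cases c
    · left
      rw [hc] at h1
      simpa [sub_eq_zero] using h1.symm
    · right
      rw [hc, mul_one] at h1
      rw [h1]
      ring
  · rintro (rfl | rfl)
    · rfl
    · rw [map_add, proj_half, add_zero]

variable [NeZero N]

instance : Finite (HexVertex N) :=
  Finite.of_injective (fun p : HexVertex N => (p.pt, p.idx, p.up)) fun p q h => by
    simp only [Prod.mk.injEq] at h
    exact HexVertex.ext h.1 h.2.1 h.2.2

theorem natCard : Nat.card (HexVertex N) = 2 * N * 3 ^ (N + 1) := by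
  have : HexVertex N ≃ Heisenberg N × ZMod N × Bool :=
    ⟨fun p => (p.pt, p.idx, p.up), fun p => ⟨p.1, p.2.1, p.2.2⟩, fun _ => rfl, fun _ => rfl⟩
  rw [Nat.card_congr this, Nat.card_prod, Nat.card_prod, Heisenberg.natCard, Nat.card_zmod,
    Nat.card_eq_fintype_card, Fintype.card_bool]
  ring

/-- The upper vertex `(x, i)` is linked to the lower vertex `(x, i + 1)` and to the two lower
vertices `(x (± e i, 1), i)`, the sign being a choice of a lift of `i` to `ℤ/2N`. -/
def Link (p q : HexVertex N) : Prop :=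
  p.up = true ∧ q.up = false ∧ ((q.pt = p.pt ∧ q.idx = p.idx + 1) ∨
    (q.idx = p.idx ∧ ∃ k, proj N k = p.idx ∧ q.pt = p.pt * ⟨e k, 1⟩))

/-- The graph of hexagons `(x, i) ~ (x (± e i, 1), i)` joined by the edges
`(x, i) ~ (x, i + 1)`. Because of the central component `1` in the
edges of the hexagons, an automorphism fixing a vertex has to commute with the centre, see
`ptMap_mul_central`. -/
def hexGraph (N : ℕ) [NeZero N] : SimpleGraph (HexVertex N) where
  Adj p q := Link p q ∨ Link q p
  symm := ⟨fun _ _ h => h.symm⟩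
  loopless := ⟨fun p h => by
    have : ¬ Link p p := fun h => absurd (h.1.symm.trans h.2.1) (by simp)
    exact h.elim this this⟩

/-- The action of the semidirect product on vertices. -/
instance : MulAction (Heisenberg N ⋊[dihedralTwist N] DihedralGroup (2 * N)) (HexVertex N) where
  smul g p := match g.right with
    | .r k => ⟨g.left * g.right • p.pt, p.idx + proj N k, p.up⟩
    | .sr k => ⟨g.left * g.right • p.pt, -(p.idx + proj N k), !p.up⟩
  one_smul p := by
    change (⟨1 * (1 : DihedralGroup (2 * N)) • p.pt, p.idx + proj N 0, p.up⟩ : HexVertex N) = p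
    rw [one_mul, one_smul, map_zero, add_zero]
  mul_smul g h p := by
    obtain ⟨v, g⟩ := g
    obtain ⟨w, h⟩ := h
    have key : v * g • w * (g * h) • p.pt = v * g • (w * h • p.pt) := by
      rw [smul_mul', mul_smul, mul_assoc]
    rcases g with a | a <;> rcases h with b | b
    · refine HexVertex.ext key ?_ rfl
      change p.idx + proj N (a + b) = p.idx + proj N b + proj N a
      rw [map_add]; ring
    · refine HexVertex.ext key ?_ rfl
      change -(p.idx + proj N (b - a)) = -(p.idx + proj N b) + proj N a
      rw [map_sub]; ring
    · refine HexVertex.ext key ?_ rfl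
      change -(p.idx + proj N (a + b)) = -(p.idx + proj N b + proj N a)
      rw [map_add]; ring
    · refine HexVertex.ext key ?_ (Bool.not_not p.up).symm
      change p.idx + proj N (b - a) = -(-(p.idx + proj N b) + proj N a)
      rw [map_sub]; ring

theorem smul_r (v : Heisenberg N) (k : ZMod (2 * N)) (p : HexVertex N) :
    (⟨v, r k⟩ : Heisenberg N ⋊[dihedralTwist N] DihedralGroup (2 * N)) • p =
      ⟨v * (r k : DihedralGroup (2 * N)) • p.pt, p.idx + proj N k, p.up⟩ := rfl

theorem smul_sr (v : Heisenberg N) (k : ZMod (2 * N)) (p : HexVertex N) :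
    (⟨v, sr k⟩ : Heisenberg N ⋊[dihedralTwist N] DihedralGroup (2 * N)) • p =
      ⟨v * (sr k : DihedralGroup (2 * N)) • p.pt, -(p.idx + proj N k), !p.up⟩ := rfl

/-- Rotations keep the two sides, reflections exchange them. -/
theorem Link.smul {p q : HexVertex N} (h : Link p q)
    (g : Heisenberg N ⋊[dihedralTwist N] DihedralGroup (2 * N)) :
    Link (g • p) (g • q) ∨ Link (g • q) (g • p) := by
  obtain ⟨v, g⟩ := g
  obtain ⟨hp, hq, h⟩ := h
  rcases g with a | a
  · left
    rw [smul_r, smul_r]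
    refine ⟨hp, hq, ?_⟩
    rcases h with ⟨h1, h2⟩ | ⟨h1, k, h2, h3⟩
    · left
      refine ⟨by simp only [h1], ?_⟩
      simp only [h2]; ring
    · right
      refine ⟨by simp only [h1], (r a : DihedralGroup (2 * N)) • k, ?_, ?_⟩
      · simp only [r_smul, map_add, h2]
      · simp only [h3, smul_mul', mul_assoc, dihedral_smul_mk_e, sign_r, mul_one]
  · right
    rw [smul_sr, smul_sr]
    refine ⟨by simp [hq], by simp [hp], ?_⟩
    rcases h with ⟨h1, h2⟩ | ⟨h1, k, h2, h3⟩
    · left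
      refine ⟨by simp only [h1], ?_⟩
      simp only [h2]; ring
    · right
      -- the reflection inverts the central factor, so the other lift is needed on the way back
      refine ⟨by simp only [h1], (sr a : DihedralGroup (2 * N)) • k + (N : ZMod (2 * N)), ?_, ?_⟩
      · simp only [sr_smul, map_add, map_neg, h1, h2, proj_half, add_zero]
      · simp only
        rw [h3, smul_mul', mul_assoc, mul_assoc]
        congr 1
        rw [left_eq_mul]
        ext1
        · simp [dihedral_smul_e, e_add_half]
        · simp [dihedral_smul_e, e_add_half, form_neg_right]

/-- The semidirect product as a group of graph automorphisms. -/
def toAut (N : ℕ) [NeZero N] :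
    Heisenberg N ⋊[dihedralTwist N] DihedralGroup (2 * N) →* (hexGraph N ≃g hexGraph N) where
  toFun g :=
    { toEquiv := MulAction.toPerm g
      map_rel_iff' := by
        have key : ∀ (g : Heisenberg N ⋊[dihedralTwist N] DihedralGroup (2 * N)) {p q},
            (hexGraph N).Adj p q → (hexGraph N).Adj (g • p) (g • q) := fun g p q h =>
          h.elim (fun h => h.smul g) (fun h => (h.smul g).symm)
        intro p q
        refine ⟨fun h => ?_, key g⟩
        have := key g⁻¹ h
        simpa using this }
  map_one' := RelIso.ext fun p => by
    change (1 : Heisenberg N ⋊[dihedralTwist N] DihedralGroup (2 * N)) • p = p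
    exact one_smul _ p
  map_mul' g h := RelIso.ext fun p => mul_smul g h p

theorem toAut_apply (g : Heisenberg N ⋊[dihedralTwist N] DihedralGroup (2 * N))
    (p : HexVertex N) : toAut N g p = g • p := rfl

theorem exists_smul_eq (p q : HexVertex N) :
    ∃ g : Heisenberg N ⋊[dihedralTwist N] DihedralGroup (2 * N), g • p = q := by
  by_cases h : p.up = q.up
  · obtain ⟨k, hk⟩ := proj_surjective (q.idx - p.idx)
    refine ⟨⟨q.pt * ((r k : DihedralGroup (2 * N)) • p.pt)⁻¹, r k⟩, ?_⟩
    rw [smul_r]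
    ext1
    · simp
    · simp [hk]
    · exact h
  · obtain ⟨k, hk⟩ := proj_surjective (-q.idx - p.idx)
    refine ⟨⟨q.pt * ((sr k : DihedralGroup (2 * N)) • p.pt)⁻¹, sr k⟩, ?_⟩
    rw [smul_sr]
    ext1
    · simp
    · simp [hk]
    · exact Bool.not_eq.2 h

theorem toAut_injective : Function.Injective (toAut N) := by
  rw [injective_iff_map_eq_one]
  rintro ⟨v, g⟩ h
  have hfix : ∀ p : HexVertex N,
      (⟨v, g⟩ : Heisenberg N ⋊[dihedralTwist N] DihedralGroup (2 * N)) • p = p := fun p => by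
    rw [← toAut_apply, h]; rfl
  rcases g with k | k
  · have h1 := fun x => congrArg pt (hfix ⟨x, 0, true⟩)
    have h2 := congrArg idx (hfix ⟨1, 0, true⟩)
    simp only [smul_r] at h1 h2
    have hv : v = 1 := by simpa using h1 1
    subst hv
    rw [zero_add, ← map_zero (proj N), proj_eq_iff, zero_add] at h2
    rcases h2 with rfl | rfl
    · rfl
    · have h3 := congrArg vec (h1 ⟨e 0, 0⟩)
      simp only [one_mul, dihedral_smul_vec, half_turn_smul_vec] at h3
      have h4 := congrArg (fun f : Antiperiodic N => f 0) h3
      simp only [neg_apply, e_self] at h4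
      exact absurd h4 (by decide)
  · have := congrArg up (hfix ⟨1, 0, true⟩)
    rw [smul_sr] at this
    simp at this

end HexVertex

/-! ### Adjacency -/

namespace Heisenberg

open Antiperiodic

variable {N : ℕ} [NeZero N]

/-- The element `(a e_k, s)`. -/
def ray (k : ZMod (2 * N)) (a s : ZMod 3) : Heisenberg N := ⟨a • e k, s⟩

@[simp] theorem ray_vec (k : ZMod (2 * N)) (a s : ZMod 3) :
    (ray k a s : Heisenberg N).vec = a • e k := rfl
@[simp] theorem ray_cen (k : ZMod (2 * N)) (a s : ZMod 3) :
    (ray k a s : Heisenberg N).cen = s := rfl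

theorem ray_one (k : ZMod (2 * N)) (s : ZMod 3) : ray k 1 s = ⟨e k, s⟩ :=
  Heisenberg.ext (one_smul _ _) rfl

theorem ray_mul_ray (k : ZMod (2 * N)) (a b s t : ZMod 3) :
    ray k a s * ray k b t = ray k (a + b) (s + t) := by
  ext1
  · simp [add_smul]
  · simp [form_smul_left, form_smul_right]

theorem mul_ray_mul_ray (x : Heisenberg N) (k : ZMod (2 * N)) (a b s t : ZMod 3) :
    x * ray k a s * ray k b t = x * ray k (a + b) (s + t) := by
  rw [mul_assoc, ray_mul_ray]

theorem ray_zero (k : ZMod (2 * N)) (s : ZMod 3) : ray k 0 s = central s :=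
  Heisenberg.ext (zero_smul _ _) rfl

theorem ray_add_half (k : ZMod (2 * N)) (a s : ZMod 3) :
    ray (k + (N : ZMod (2 * N))) a s = ray k (-a) s := by
  ext1
  · ext j
    simp [e_add_half]
  · rfl

theorem ray_injective (k : ZMod (2 * N)) (s : ZMod 3) :
    Function.Injective fun a => (ray k a s : Heisenberg N) := fun a b h => by
  have := congrArg (fun x : Heisenberg N => x.vec k) h
  simpa [e_self] using this

end Heisenberg

namespace HexVertex

open Antiperiodic Heisenberg

theorem natCast_mul_self_eq_one {N : ℕ} (h3 : ¬ 3 ∣ N) : (N : ZMod 3) * N = 1 := by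
  have : (N : ZMod 3) ≠ 0 := by rwa [Ne, ZMod.natCast_eq_zero_iff]
  generalize (N : ZMod 3) = t at this
  revert t; decide

variable {N : ℕ} [NeZero N]

theorem adj_up {x : Heisenberg N} {k : ZMod (2 * N)} {q : HexVertex N} :
    (hexGraph N).Adj ⟨x, proj N k, true⟩ q ↔ q = ⟨x, proj N k + 1, false⟩ ∨
      ∃ a : ZMod 3, a ≠ 0 ∧ q = ⟨x * ray k a 1, proj N k, false⟩ := by
  constructor
  · rintro (⟨-, hq, h⟩ | ⟨-, h, -⟩)
    · rcases h with ⟨h1, h2⟩ | ⟨h1, l, h2, h3⟩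
      · exact Or.inl (HexVertex.ext h1 h2 hq)
      · right
        rcases proj_eq_iff.1 h2 with rfl | rfl
        · exact ⟨1, by decide, HexVertex.ext (by rw [h3, ray_one]) h1 hq⟩
        · exact ⟨-1, by decide, HexVertex.ext (by rw [h3, ← ray_one, ray_add_half]) h1 hq⟩
    · simp at h
  · rintro (rfl | ⟨a, ha, rfl⟩)
    · exact Or.inl ⟨rfl, rfl, Or.inl ⟨rfl, rfl⟩⟩
    · refine Or.inl ⟨rfl, rfl, Or.inr ⟨rfl, ?_⟩⟩
      have ha' : a = 1 ∨ a = -1 := by revert a; decide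
      rcases ha' with rfl | rfl
      · exact ⟨k, rfl, by rw [ray_one]⟩
      · exact ⟨k + (N : ZMod (2 * N)), proj_eq_iff.2 (Or.inr rfl),
          by rw [← ray_one, ray_add_half]⟩

theorem adj_down {x : Heisenberg N} {k : ZMod (2 * N)} {q : HexVertex N} :
    (hexGraph N).Adj ⟨x, proj N k, false⟩ q ↔ q = ⟨x, proj N k - 1, true⟩ ∨
      ∃ a : ZMod 3, a ≠ 0 ∧ q = ⟨x * ray k a (-1), proj N k, true⟩ := by
  rw [SimpleGraph.adj_comm]
  obtain ⟨y, i, b⟩ := q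
  obtain ⟨l, rfl⟩ := proj_surjective i
  cases b
  · refine iff_of_false ?_ (by simp)
    rintro (⟨h, -⟩ | ⟨h, -⟩) <;> simp at h
  · rw [adj_up]
    simp only [HexVertex.mk.injEq, and_true]
    refine or_congr ?_ ?_
    · rw [eq_comm, eq_sub_iff_add_eq]
      exact and_congr_right fun _ => eq_comm
    · constructor
      · rintro ⟨a, ha, rfl, h2⟩
        rcases proj_eq_iff.1 h2 with rfl | rfl
        · refine ⟨-a, neg_ne_zero.2 ha, ?_, rfl⟩
          rw [mul_ray_mul_ray, add_neg_cancel, add_neg_cancel, ray_zero, central_zero, mul_one]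
        · refine ⟨a, ha, ?_, h2.symm⟩
          rw [ray_add_half, mul_ray_mul_ray, add_neg_cancel, add_neg_cancel, ray_zero,
            central_zero, mul_one]
      · rintro ⟨a, ha, rfl, h2⟩
        rcases proj_eq_iff.1 h2 with rfl | rfl
        · refine ⟨-a, neg_ne_zero.2 ha, ?_, rfl⟩
          rw [mul_ray_mul_ray, add_neg_cancel, neg_add_cancel, ray_zero, central_zero, mul_one]
        · refine ⟨a, ha, ?_, h2.symm⟩
          rw [ray_add_half, mul_ray_mul_ray, add_neg_cancel, neg_add_cancel, ray_zero,
            central_zero, mul_one]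

/-! ### The graph is cubic, connected and vertex-transitive -/

theorem ncard_neighborSet (p : HexVertex N) : ((hexGraph N).neighborSet p).ncard = 3 := by
  have base : ((hexGraph N).neighborSet ⟨1, proj N 0, true⟩).ncard = 3 := by
    have : (hexGraph N).neighborSet ⟨1, proj N 0, true⟩ =
        {⟨1, proj N 0 + 1, false⟩, ⟨ray 0 1 1, proj N 0, false⟩,
          ⟨ray 0 (-1) 1, proj N 0, false⟩} := by
      ext q
      rw [SimpleGraph.mem_neighborSet, adj_up]
      simp only [Set.mem_insert_iff, Set.mem_singleton_iff, one_mul]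
      refine or_congr Iff.rfl ⟨?_, ?_⟩
      · rintro ⟨a, ha, rfl⟩
        have ha' : a = 1 ∨ a = -1 := by revert a; decide
        rcases ha' with rfl | rfl
        · exact Or.inl rfl
        · exact Or.inr rfl
      · rintro (rfl | rfl)
        · exact ⟨1, by decide, rfl⟩
        · exact ⟨-1, by decide, rfl⟩
    have h1 : ∀ a : ZMod 3, (1 : Heisenberg N) ≠ ray 0 a 1 := fun a h => by
      simpa using congrArg cen h
    have h2 : (ray 0 1 1 : Heisenberg N) ≠ ray 0 (-1) 1 := fun h =>
      absurd (ray_injective 0 1 h) (by decide)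
    rw [this, Set.ncard_eq_three]
    exact ⟨_, _, _, fun h => h1 _ (congrArg pt h), fun h => h1 _ (congrArg pt h),
      fun h => h2 (congrArg pt h), rfl⟩
  obtain ⟨g, hg⟩ := exists_smul_eq (⟨1, proj N 0, true⟩ : HexVertex N) p
  rw [← base, ← hg, ← toAut_apply]
  exact (Nat.card_congr ((toAut N g).mapNeighborSet _)).symm

/-- Three steps along a hexagon lead from `(x, i)` to its antipode, the lower vertex
`(x (0, 1), i)`. -/
theorem reachable_pred (x : Heisenberg N) (i : ZMod N) :
    (hexGraph N).Reachable ⟨x, i, true⟩ ⟨x * central 1, i - 1, true⟩ := by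
  obtain ⟨k, rfl⟩ := proj_surjective i
  refine (adj_up.2 (Or.inr ⟨1, by decide, rfl⟩)).reachable.trans ?_
  refine (adj_down.2 (Or.inr ⟨1, by decide, rfl⟩)).reachable.trans ?_
  refine (adj_up.2 (Or.inr ⟨1, by decide, rfl⟩)).reachable.trans ?_
  refine (adj_down.2 (Or.inl ?_)).reachable
  rw [mul_ray_mul_ray, mul_ray_mul_ray, ← ray_zero k]
  rfl

theorem reachable_ray (x : Heisenberg N) (k : ZMod (2 * N)) :
    (hexGraph N).Reachable ⟨x, proj N k, true⟩ ⟨x * ray k (-1) 0, proj N k, true⟩ := by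
  refine (adj_up.2 (Or.inr ⟨1, by decide, rfl⟩)).reachable.trans ?_
  refine (adj_down.2 (Or.inr ⟨1, by decide, ?_⟩)).reachable
  rw [mul_ray_mul_ray]
  rfl

theorem reachable_sub (x : Heisenberg N) (i : ZMod N) (n : ℕ) :
    (hexGraph N).Reachable ⟨x, i, true⟩ ⟨x * central n, i - (n : ZMod N), true⟩ := by
  induction n with
  | zero => simp [central_zero]
  | succ n ih =>
    refine ih.trans ?_
    have := reachable_pred (x * central n) (i - (n : ZMod N))
    rw [mul_assoc, central_mul_central, sub_sub] at this
    exact_mod_cast this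

theorem reachable_central (h3 : ¬ 3 ∣ N) (x : Heisenberg N) (i : ZMod N) (s : ZMod 3) :
    (hexGraph N).Reachable ⟨x, i, true⟩ ⟨x * central s, i, true⟩ := by
  have := reachable_sub x i (N * N * s.val)
  push_cast at this
  rwa [natCast_mul_self_eq_one h3, ZMod.natCast_zmod_val, one_mul, ZMod.natCast_self, zero_mul,
    zero_mul, sub_zero] at this

theorem reachable_sub_one (h3 : ¬ 3 ∣ N) (x : Heisenberg N) (i : ZMod N) :
    (hexGraph N).Reachable ⟨x, i, true⟩ ⟨x, i - 1, true⟩ := by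
  refine (reachable_pred x i).trans ?_
  have := reachable_central h3 (x * central 1) (i - 1) (-1)
  rwa [mul_assoc, central_mul_central, add_neg_cancel, central_zero, mul_one] at this

theorem reachable_idx (h3 : ¬ 3 ∣ N) (x : Heisenberg N) (i j : ZMod N) :
    (hexGraph N).Reachable ⟨x, i, true⟩ ⟨x, j, true⟩ := by
  have key : ∀ n : ℕ, (hexGraph N).Reachable ⟨x, i, true⟩ ⟨x, i - (n : ZMod N), true⟩ := by
    intro n
    induction n with
    | zero => simp
    | succ n ih =>
      refine ih.trans ?_
      have := reachable_sub_one h3 x (i - (n : ZMod N))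
      rw [sub_sub] at this
      exact_mod_cast this
  have := key (i - j).val
  rwa [ZMod.natCast_zmod_val, sub_sub_cancel] at this

theorem reachable_pt (h3 : ¬ 3 ∣ N) (x y : Heisenberg N) :
    (hexGraph N).Reachable ⟨x, 0, true⟩ ⟨y, 0, true⟩ := by
  let H : Subgroup (Heisenberg N) :=
    { carrier := {v | ∀ x : Heisenberg N,
        (hexGraph N).Reachable ⟨x, 0, true⟩ ⟨x * v, 0, true⟩}
      one_mem' := fun x => by rw [mul_one]
      mul_mem' := fun {v w} hv hw x => (hv x).trans (by rw [← mul_assoc]; exact hw (x * v))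
      inv_mem' := fun {v} hv x => by
        have := (hv (x * v⁻¹)).symm
        rwa [inv_mul_cancel_right] at this }
  have hH : H = ⊤ := by
    refine eq_top_of_generators_mem H (fun s x => reachable_central h3 x 0 s) fun k x => ?_
    refine (reachable_idx h3 x 0 (proj N k)).trans
      (SimpleGraph.Reachable.trans ?_ (reachable_idx h3 _ (proj N k) 0))
    have := reachable_ray x (k + (N : ZMod (2 * N)))
    rwa [ray_add_half, neg_neg, ray_one, proj_eq_iff.2 (Or.inr rfl)] at this
  have : x⁻¹ * y ∈ H := hH ▸ Subgroup.mem_top _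
  simpa using this x

theorem isCubicVertexTransitive (h3 : ¬ 3 ∣ N) : (hexGraph N).IsCubicVertexTransitive where
  connected := by
    rw [SimpleGraph.connected_iff_exists_forall_reachable]
    have up : ∀ (x : Heisenberg N) (i : ZMod N),
        (hexGraph N).Reachable ⟨1, 0, true⟩ ⟨x, i, true⟩ := fun x i =>
      (reachable_pt h3 1 x).trans (reachable_idx h3 x 0 i)
    refine ⟨⟨1, 0, true⟩, ?_⟩
    rintro ⟨x, i, b⟩
    obtain ⟨k, rfl⟩ := proj_surjective i
    cases b
    · exact (up x (proj N k - 1)).trans (adj_down.2 (Or.inl rfl)).symm.reachable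
    · exact up _ _
  cubic := ncard_neighborSet
  transitive u v := by
    obtain ⟨g, hg⟩ := exists_smul_eq u v
    exact ⟨toAut N g, hg⟩

end HexVertex

/-! ### Recognising the hexagons -/

/-- The directed edge `(p, q)` starts a non-backtracking closed walk of length `6`. -/
def SimpleGraph.OnHexagon {Ω : Type*} (Γ : SimpleGraph Ω) (p q : Ω) : Prop :=
  ∃ u v w z, Γ.Adj q u ∧ Γ.Adj u v ∧ Γ.Adj v w ∧ Γ.Adj w z ∧ Γ.Adj z p ∧
    p ≠ u ∧ q ≠ v ∧ u ≠ w ∧ v ≠ z ∧ w ≠ p ∧ z ≠ q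

theorem SimpleGraph.OnHexagon.map {Ω : Type*} {Γ : SimpleGraph Ω} {p q : Ω}
    (h : Γ.OnHexagon p q) (α : Γ ≃g Γ) : Γ.OnHexagon (α p) (α q) := by
  obtain ⟨u, v, w, z, h⟩ := h
  refine ⟨α u, α v, α w, α z, ?_⟩
  simpa only [SimpleGraph.Iso.map_adj_iff, ne_eq, EmbeddingLike.apply_eq_iff_eq] using h

theorem SimpleGraph.onHexagon_map_iff {Ω : Type*} {Γ : SimpleGraph Ω} {p q : Ω} (α : Γ ≃g Γ) :
    Γ.OnHexagon (α p) (α q) ↔ Γ.OnHexagon p q :=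
  ⟨fun h => by simpa using h.map α.symm, fun h => h.map α⟩

namespace HexVertex

open Antiperiodic Heisenberg

variable {N : ℕ}

theorem proj_add_one_ne (hN : 2 ≤ N) (k : ZMod (2 * N)) : proj N (k + 1) ≠ proj N k := by
  have : Nontrivial (ZMod N) := ZMod.nontrivial_iff.2 (by omega)
  rw [map_add, map_one]
  simp

variable [NeZero N]

theorem mul_ray_inj {x : Heisenberg N} {k : ZMod (2 * N)} {a b s : ZMod 3} :
    x * ray k a s = x * ray k b s ↔ a = b := by
  rw [mul_right_inj]
  exact (ray_injective k s).eq_iff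

theorem mul_ray_zero_eq_self {x : Heisenberg N} {k : ZMod (2 * N)} {a : ZMod 3} :
    x * ray k a 0 = x ↔ a = 0 := by
  rw [← mul_ray_inj (x := x) (k := k) (s := 0), ray_zero, central_zero, mul_one]

theorem e_apply_of_proj_ne {k j : ZMod (2 * N)} (h : proj N j ≠ proj N k) : e k j = 0 :=
  e_apply_of_ne (fun h' => h (proj_eq_iff.2 (Or.inl h'))) fun h' => h (proj_eq_iff.2 (Or.inr h'))

theorem onHexagon_ray (x : Heisenberg N) (k : ZMod (2 * N)) {a : ZMod 3} (ha : a ≠ 0) :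
    (hexGraph N).OnHexagon ⟨x, proj N k, true⟩ ⟨x * ray k a 1, proj N k, false⟩ := by
  have up : ∀ s t : ZMod 3, s + a = t →
      (hexGraph N).Adj ⟨x * ray k s 0, proj N k, true⟩ ⟨x * ray k t 1, proj N k, false⟩ := by
    rintro s t rfl
    refine adj_up.2 (Or.inr ⟨a, ha, ?_⟩)
    rw [mul_ray_mul_ray, zero_add]
  have down : ∀ s t : ZMod 3, s + a = t →
      (hexGraph N).Adj ⟨x * ray k s 1, proj N k, false⟩ ⟨x * ray k t 0, proj N k, true⟩ := by
    rintro s t rfl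
    refine adj_down.2 (Or.inr ⟨a, ha, ?_⟩)
    rw [mul_ray_mul_ray, add_neg_cancel]
  have hx : x = x * ray k 0 0 := (mul_ray_zero_eq_self.2 rfl).symm
  have h1 : a + a = -a ∧ -a + a = 0 ∧ 0 + a = a ∧ -a ≠ 0 ∧ a ≠ -a := by
    clear * - ha
    revert a; decide
  obtain ⟨h1, h2, h3, h4, h5⟩ := h1
  rw [hx, mul_ray_mul_ray, zero_add, zero_add]
  refine ⟨⟨x * ray k (-a) 0, proj N k, true⟩, ⟨x * ray k 0 1, proj N k, false⟩,
    ⟨x * ray k a 0, proj N k, true⟩, ⟨x * ray k (-a) 1, proj N k, false⟩,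
    down _ _ h1, up _ _ h2, down _ _ h3, up _ _ h1, down _ _ h2, ?_⟩
  simp only [ne_eq, HexVertex.mk.injEq, and_true, mul_ray_inj]
  exact ⟨h4.symm, ha, h5.symm, h4.symm, ha, h5.symm⟩

/-- The edges `(x, i) ~ (x, i + 1)` lie on no closed walk of length `6`: the components in
`Antiperiodic N` of the steps of such a walk would give a nontrivial linear relation between
`e i` and `e (i + 1)`, unless the walk winds around a cycle `ℤ/N` of length dividing `3`. -/
theorem not_onHexagon (hN : 2 ≤ N) (h3 : ¬ 3 ∣ N) (x : Heisenberg N) (i : ZMod N) :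
    ¬ (hexGraph N).OnHexagon ⟨x, i, true⟩ ⟨x, i + 1, false⟩ := by
  obtain ⟨k, rfl⟩ := proj_surjective i
  have hsucc : ∀ k : ZMod (2 * N), proj N k + 1 = proj N (k + 1) := fun k => by
    rw [map_add, map_one]
  have e1 : e k (k + 1) = 0 := e_apply_of_proj_ne (proj_add_one_ne hN k)
  have e2 : e (k + 1) k = 0 := e_apply_of_proj_ne (proj_add_one_ne hN k).symm
  have e3 : e (k + 1 + 1) (k + 1) = 0 := e_apply_of_proj_ne (proj_add_one_ne hN (k + 1)).symm
  rintro ⟨u, v, w, z, h1, h2, h3', h4, h5, n1, n2, -, -, n5, n6⟩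
  rw [hsucc] at h1 n2 n6
  rcases adj_down.1 h1 with rfl | ⟨a, ha, rfl⟩
  · exact n1 (by rw [map_add, map_one, add_sub_cancel_right])
  rcases adj_up.1 h5.symm with rfl | ⟨b, hb, rfl⟩
  · exact n6 (by rw [hsucc])
  -- the three remaining edges join `u` to `z`; determine `v` and `w`, then the edge between them
  have hv : (∃ c, a + c ≠ 0 ∧ v = ⟨x * ray (k + 1) (a + c) 0, proj N (k + 1), false⟩) ∨
      v = ⟨x * ray (k + 1) a (-1), proj N (k + 1 + 1), false⟩ := by
    rcases adj_up.1 h2 with rfl | ⟨c, -, rfl⟩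
    · rw [hsucc]; exact Or.inr rfl
    · rw [mul_ray_mul_ray, neg_add_cancel] at n2 ⊢
      refine Or.inl ⟨c, fun h => n2 ?_, rfl⟩
      rw [h, mul_ray_zero_eq_self.2 rfl]
  have hw : (∃ d, b + d ≠ 0 ∧ w = ⟨x * ray k (b + d) 0, proj N k, true⟩) ∨
      w = ⟨x * ray k b 1, proj N k - 1, true⟩ := by
    rcases adj_down.1 h4.symm with rfl | ⟨c, -, rfl⟩
    · exact Or.inr rfl
    · rw [mul_ray_mul_ray, add_neg_cancel] at n5 ⊢
      refine Or.inl ⟨c, fun h => n5 ?_, rfl⟩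
      rw [h, mul_ray_zero_eq_self.2 rfl]
  have eval : ∀ {y y' : Heisenberg N} (j : ZMod (2 * N)), y = y' → y.vec j = y'.vec j :=
    fun j h => by rw [h]
  rcases hv with ⟨c, hc, rfl⟩ | rfl <;> rcases hw with ⟨d, hd, rfl⟩ | rfl <;>
    rcases adj_down.1 h3' with h | ⟨f, -, h⟩ <;>
    simp only [HexVertex.mk.injEq, and_true] at h <;> obtain ⟨hx, hi⟩ := h
  · exact hd (by simpa [e_self, e2] using eval k hx)
  · exact proj_add_one_ne hN k hi.symm
  · exact hb (by simpa [e_self, e2] using eval k hx)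
  · exact hb (by simpa [e_self, e2] using eval k hx)
  · exact ha (by simpa [e_self, e1] using (eval (k + 1) hx).symm)
  · exact ha (by simpa [e_self, e1, e3] using (eval (k + 1) hx).symm)
  · exact hb (by simpa [e_self, e2] using eval k hx)
  · have h0 : ((3 : ℕ) : ZMod N) = 0 := by
      rw [map_add, map_add, map_one] at hi
      push_cast
      linear_combination -hi
    rw [ZMod.natCast_eq_zero_iff, Nat.dvd_prime Nat.prime_three] at h0
    rcases h0 with rfl | rfl
    · omega
    · exact h3 dvd_rfl

/-! ### Automorphisms fixing a vertex -/

section Rigidity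

variable (α : hexGraph N ≃g hexGraph N)

theorem map_succ (hN : 2 ≤ N) (h3 : ¬ 3 ∣ N) {x y : Heisenberg N} {i : ZMod N}
    (h : α ⟨x, i, true⟩ = ⟨y, i, true⟩) : α ⟨x, i + 1, false⟩ = ⟨y, i + 1, false⟩ := by
  obtain ⟨k, rfl⟩ := proj_surjective i
  have hadj := α.map_adj_iff.2 (adj_up (x := x) (k := k).2 (Or.inl rfl))
  have hhex := mt (SimpleGraph.onHexagon_map_iff α).1 (not_onHexagon hN h3 x (proj N k))
  rw [h] at hadj hhex
  rcases adj_up.1 hadj with h' | ⟨a, ha, h'⟩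
  · exact h'
  · rw [h'] at hhex
    exact absurd (onHexagon_ray y k ha) hhex

theorem map_pred (hN : 2 ≤ N) (h3 : ¬ 3 ∣ N) {x y : Heisenberg N} {i : ZMod N}
    (h : α ⟨x, i, false⟩ = ⟨y, i, false⟩) : α ⟨x, i - 1, true⟩ = ⟨y, i - 1, true⟩ := by
  obtain ⟨k, rfl⟩ := proj_surjective i
  have hadj := α.map_adj_iff.2 (adj_down (x := x) (k := k).2 (Or.inl rfl))
  have hhex := mt (SimpleGraph.onHexagon_map_iff α).1 (not_onHexagon hN h3 x (proj N k - 1))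
  rw [sub_add_cancel] at hhex
  rw [h] at hadj hhex
  rcases adj_down.1 hadj with h' | ⟨a, ha, h'⟩
  · exact h'
  · rw [h'] at hhex
    have := onHexagon_ray (y * ray k a (-1)) k (neg_ne_zero.2 ha)
    rw [mul_ray_mul_ray, add_neg_cancel, neg_add_cancel, mul_ray_zero_eq_self.2 rfl] at this
    exact absurd this hhex

theorem map_up_ray (hN : 2 ≤ N) (h3 : ¬ 3 ∣ N) {x y : Heisenberg N} {k : ZMod (2 * N)}
    (h : α ⟨x, proj N k, true⟩ = ⟨y, proj N k, true⟩) {a : ZMod 3} (ha : a ≠ 0) :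
    ∃ b : ZMod 3, b ≠ 0 ∧
      α ⟨x * ray k a 1, proj N k, false⟩ = ⟨y * ray k b 1, proj N k, false⟩ := by
  have hadj := α.map_adj_iff.2 (adj_up (x := x) (k := k).2 (Or.inr ⟨a, ha, rfl⟩))
  rw [h] at hadj
  rcases adj_up.1 hadj with h' | h'
  · have := (onHexagon_ray x k ha).map α
    rw [h, h'] at this
    exact absurd this (not_onHexagon hN h3 _ _)
  · exact h'

theorem map_down_ray (hN : 2 ≤ N) (h3 : ¬ 3 ∣ N) {x y : Heisenberg N} {k : ZMod (2 * N)}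
    (h : α ⟨x, proj N k, false⟩ = ⟨y, proj N k, false⟩) {a : ZMod 3} (ha : a ≠ 0) :
    ∃ b : ZMod 3, b ≠ 0 ∧
      α ⟨x * ray k a (-1), proj N k, true⟩ = ⟨y * ray k b (-1), proj N k, true⟩ := by
  have hadj := α.map_adj_iff.2 (adj_down (x := x) (k := k).2 (Or.inr ⟨a, ha, rfl⟩))
  rw [h] at hadj
  rcases adj_down.1 hadj with h' | h'
  · have hhex := onHexagon_ray (x * ray k a (-1)) k (neg_ne_zero.2 ha)
    rw [mul_ray_mul_ray, add_neg_cancel, neg_add_cancel, mul_ray_zero_eq_self.2 rfl] at hhex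
    have := hhex.map α
    rw [h, h'] at this
    have h0 := not_onHexagon hN h3 y (proj N k - 1)
    rw [sub_add_cancel] at h0
    exact absurd this h0
  · exact h'

/-- An automorphism fixing a vertex preserves positions and sides: this propagates along edges. -/
theorem map_idx_up (hN : 2 ≤ N) (h3 : ¬ 3 ∣ N) {o : HexVertex N} (ho : α o = o) (p : HexVertex N) :
    (α p).idx = p.idx ∧ (α p).up = p.up := by
  have hr := (SimpleGraph.reachable_iff_reflTransGen o p).1
    ((isCubicVertexTransitive h3).connected.preconnected o p)
  induction hr with
  | refl => rw [ho]; exact ⟨rfl, rfl⟩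
  | @tail p q _ hadj ih =>
    obtain ⟨x, i, b⟩ := p
    obtain ⟨k, rfl⟩ := proj_surjective i
    obtain ⟨y, hy⟩ : ∃ y, α ⟨x, proj N k, b⟩ = ⟨y, proj N k, b⟩ :=
      ⟨_, HexVertex.ext rfl ih.1 ih.2⟩
    cases b
    · rcases adj_down.1 hadj with rfl | ⟨a, ha, rfl⟩
      · rw [map_pred α hN h3 hy]; exact ⟨rfl, rfl⟩
      · obtain ⟨b, -, hb⟩ := map_down_ray α hN h3 hy ha
        rw [hb]; exact ⟨rfl, rfl⟩
    · rcases adj_up.1 hadj with rfl | ⟨a, ha, rfl⟩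
      · rw [map_succ α hN h3 hy]; exact ⟨rfl, rfl⟩
      · obtain ⟨b, -, hb⟩ := map_up_ray α hN h3 hy ha
        rw [hb]; exact ⟨rfl, rfl⟩

/-- The map induced by an automorphism on the group elements of the upper vertices at position
`i`. -/
def ptMap (i : ZMod N) (x : Heisenberg N) : Heisenberg N := (α ⟨x, i, true⟩).pt

variable {α}

theorem map_up_eq (hN : 2 ≤ N) (h3 : ¬ 3 ∣ N) {o : HexVertex N} (ho : α o = o) (x : Heisenberg N)
    (i : ZMod N) : α ⟨x, i, true⟩ = ⟨ptMap α i x, i, true⟩ :=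
  HexVertex.ext rfl (map_idx_up α hN h3 ho _).1 (map_idx_up α hN h3 ho _).2

theorem map_down_eq (hN : 2 ≤ N) (h3 : ¬ 3 ∣ N) {o : HexVertex N} (ho : α o = o)
    (x : Heisenberg N) (i : ZMod N) : α ⟨x, i, false⟩ = ⟨ptMap α (i - 1) x, i, false⟩ := by
  have := map_succ α hN h3 (map_up_eq hN h3 ho x (i - 1))
  rwa [sub_add_cancel] at this

/-- Relative to the base points `x` and `ptMap α _ x`, an automorphism acts on the hexagon of
`(x, i)` by `t ↦ d t` with a sign `d`; in particular it respects antipodes. -/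
theorem ptMap_hexagon (hN : 2 ≤ N) (h3 : ¬ 3 ∣ N) {o : HexVertex N} (ho : α o = o)
    (x : Heisenberg N) (k : ZMod (2 * N)) :
    (∃ d : ZMod 3, d ≠ 0 ∧ ∀ t, ptMap α (proj N k) (x * ray k t 0) =
      ptMap α (proj N k) x * ray k (d * t) 0) ∧
    ptMap α (proj N k - 1) (x * central 1) = ptMap α (proj N k) x * central 1 := by
  set y := ptMap α (proj N k) x with hy
  have hxy : α ⟨x, proj N k, true⟩ = ⟨y, proj N k, true⟩ := map_up_eq hN h3 ho x _
  have inj : ∀ {s t s' t' c c' : ZMod 3} {b : Bool},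
      α ⟨x * ray k s c, proj N k, b⟩ = ⟨y * ray k s' c', proj N k, b⟩ →
      α ⟨x * ray k t c, proj N k, b⟩ = ⟨y * ray k t' c', proj N k, b⟩ → s' = t' → s = t := by
    rintro s t s' t' c c' b hs ht rfl
    have := congrArg pt (α.injective (hs.trans ht.symm))
    exact mul_ray_inj.1 this
  have up : ∀ (s a s' : ZMod 3), a ≠ 0 →
      α ⟨x * ray k s 0, proj N k, true⟩ = ⟨y * ray k s' 0, proj N k, true⟩ →
      ∃ b : ZMod 3, b ≠ 0 ∧ α ⟨x * ray k (s + a) 1, proj N k, false⟩ =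
        ⟨y * ray k (s' + b) 1, proj N k, false⟩ := by
    intro s a s' ha h
    obtain ⟨b, hb, h'⟩ := map_up_ray α hN h3 h ha
    rw [mul_ray_mul_ray, mul_ray_mul_ray, zero_add] at h'
    exact ⟨b, hb, h'⟩
  have down : ∀ (s a s' : ZMod 3), a ≠ 0 →
      α ⟨x * ray k s 1, proj N k, false⟩ = ⟨y * ray k s' 1, proj N k, false⟩ →
      ∃ b : ZMod 3, b ≠ 0 ∧ α ⟨x * ray k (s + a) 0, proj N k, true⟩ =
        ⟨y * ray k (s' + b) 0, proj N k, true⟩ := by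
    intro s a s' ha h
    obtain ⟨b, hb, h'⟩ := map_down_ray α hN h3 h ha
    rw [mul_ray_mul_ray, mul_ray_mul_ray, add_neg_cancel] at h'
    exact ⟨b, hb, h'⟩
  -- follow the hexagon from `x` in both directions
  have h0 : α ⟨x * ray k 0 0, proj N k, true⟩ = ⟨y * ray k 0 0, proj N k, true⟩ := by
    rwa [mul_ray_zero_eq_self.2 rfl, mul_ray_zero_eq_self.2 rfl]
  obtain ⟨d, hd, h1⟩ := up 0 1 0 (by decide) h0
  obtain ⟨d', hd', h2⟩ := up 0 (-1) 0 (by decide) h0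
  rw [zero_add, zero_add] at h1 h2
  have hdd : d' = -d := by
    have : d' ≠ d := fun h => absurd (inj h2 h1 h) (by decide)
    clear * - hd hd' this
    revert d d'; decide
  subst hdd
  obtain ⟨b, hb, h3'⟩ := down 1 1 d (by decide) h1
  have hbd : d + b = -d := by
    have : d + b ≠ 0 := fun h => absurd (inj h3' h0 h) (by decide)
    clear * - hd hb this
    revert d b; decide
  rw [hbd] at h3'
  obtain ⟨c, hc, h4⟩ := down (-1) (-1) (-d) (by decide) h2
  have hcd : -d + c = d := by
    have : -d + c ≠ 0 := fun h => absurd (inj h4 h0 h) (by decide)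
    clear * - hd hc this
    revert d c; decide
  rw [hcd] at h4
  obtain ⟨f, hf, h5⟩ := up (1 + 1) 1 (-d) (by decide) h3'
  have hfd : -d + f = 0 := by
    have : -d + f ≠ d := fun h => absurd (inj h5 h1 h) (by decide)
    clear * - hd hf this
    revert d f; decide
  rw [hfd] at h5
  refine ⟨⟨d, hd, fun t => ?_⟩, ?_⟩
  · have ht : t = 0 ∨ t = -1 + -1 ∨ t = 1 + 1 := by revert t; decide
    have e1 : d * (-1 + -1) = d := by clear * -; revert d; decide
    have e2 : d * (1 + 1) = -d := by clear * -; revert d; decide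
    rcases ht with rfl | rfl | rfl
    · rw [mul_zero, ptMap, h0]
    · rw [e1, ptMap, h4]
    · rw [e2, ptMap, h3']
  · have e3 : (1 + 1 + 1 : ZMod 3) = 0 := by decide
    rw [e3, ray_zero, map_down_eq hN h3 ho] at h5
    exact congrArg pt h5

theorem ptMap_sub (hN : 2 ≤ N) (h3 : ¬ 3 ∣ N) {o : HexVertex N} (ho : α o = o)
    (x : Heisenberg N) (i : ZMod N) (n : ℕ) :
    ptMap α (i - (n : ZMod N)) (x * central n) = ptMap α i x * central n := by
  induction n with
  | zero => simp [central_zero]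
  | succ n ih =>
    obtain ⟨k, hk⟩ := proj_surjective (i - (n : ZMod N))
    have := (ptMap_hexagon hN h3 ho (x * central n) k).2
    rw [hk, ih, mul_assoc, mul_assoc, central_mul_central, sub_sub] at this
    exact_mod_cast this

/-- Going `N²` times `s` positions down leads back to the same position, and `N² = 1` in `𝔽₃`. -/
theorem ptMap_mul_central (hN : 2 ≤ N) (h3 : ¬ 3 ∣ N) {o : HexVertex N} (ho : α o = o)
    (x : Heisenberg N) (i : ZMod N) (s : ZMod 3) :
    ptMap α i (x * central s) = ptMap α i x * central s := by
  have := ptMap_sub hN h3 ho x i (N * N * s.val)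
  push_cast at this
  rwa [natCast_mul_self_eq_one h3, ZMod.natCast_zmod_val, one_mul, ZMod.natCast_self, zero_mul,
    zero_mul, sub_zero] at this

theorem ptMap_eq (hN : 2 ≤ N) (h3 : ¬ 3 ∣ N) {o : HexVertex N} (ho : α o = o)
    (x : Heisenberg N) (i : ZMod N) : ptMap α i x = ptMap α 0 x := by
  have key : ∀ n : ℕ, ptMap α (i - (n : ZMod N)) x = ptMap α i x := fun n => by
    have := ptMap_sub hN h3 ho x i n
    rwa [ptMap_mul_central hN h3 ho, mul_left_inj] at this
  have := key i.val
  rwa [ZMod.natCast_zmod_val, sub_self, eq_comm] at this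

end Rigidity

end HexVertex

/-! ### Maps of the extraspecial group preserving lines -/

namespace Heisenberg

open Antiperiodic

variable {N : ℕ} [NeZero N]

/-- For `ε² = 1`, the automorphism `(f, s) ↦ (ε f, s)`, as a homomorphism. -/
def scale (ε : ZMod 3) (hε : ε * ε = 1) : Heisenberg N →* Heisenberg N where
  toFun x := ⟨ε • x.vec, x.cen⟩
  map_one' := Heisenberg.ext (smul_zero ε) rfl
  map_mul' x y := by
    ext1
    · exact smul_add ε _ _
    · simp only [mul_cen, form_smul_left, form_smul_right, ← mul_assoc, hε, one_mul]

theorem ray_mul_ray_comm (k l : ZMod (2 * N)) (a b s t : ZMod 3) :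
    ray k a s * ray l b t =
      ray l b t * ray k a s * central (2 * (a * (b * form (e k) (e l)))) := by
  ext1
  · simp [add_comm]
  · simp only [mul_cen, ray_cen, ray_vec, mul_vec, central_cen, central_vec, form_smul_left,
      form_smul_right, form_zero_right, form_swap (e k) (e l)]
    ring

/-- Rigidity of the lines `{x (t e_k, 0)}` of the Heisenberg group: a map fixing `1`, commuting
with the centre, and mapping each such line to the corresponding line through its image, by
`t ↦ d t` with a sign `d` that may depend on the line, is `(f, s) ↦ (± f, s)`. The sign depends only on
`k` because the lines commute modulo the centre, and not even on `k` because `(e_k, 0)` and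
`(e_{k+1}, 0)` have a nontrivial commutator. -/
theorem eq_scale (hN : 2 ≤ N) (β : Heisenberg N → Heisenberg N) (h1 : β 1 = 1)
    (hc : ∀ x s, β (x * central s) = β x * central s)
    (hr : ∀ x k, ∃ d : ZMod 3, d ≠ 0 ∧ ∀ t, β (x * ray k t 0) = β x * ray k (d * t) 0) :
    ∃ (ε : ZMod 3) (hε : ε * ε = 1), ∀ x, β x = scale ε hε x := by
  choose d hd0 hd using hr
  have dsq : ∀ x k, d x k * d x k = 1 := fun x k => by
    have := hd0 x k
    generalize d x k = t at this
    revert t; decide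
  have uniq : ∀ x k a, β (x * ray k 1 0) = β x * ray k a 0 → d x k = a := by
    intro x k a h
    rw [hd, mul_one] at h
    exact HexVertex.mul_ray_inj.1 h
  have dc : ∀ x s k, d (x * central s) k = d x k := by
    intro x s k
    apply uniq
    rw [mul_assoc, central_mul, ← mul_assoc, hc, hd, hc, mul_one, mul_assoc, ← central_mul,
      ← mul_assoc]
  have dray : ∀ x k t, d (x * ray k t 0) k = d x k := by
    intro x k t
    apply uniq
    rw [mul_ray_mul_ray, add_zero, hd, hd, mul_ray_mul_ray, add_zero, mul_add, mul_one]
  -- lines of different directions: compare the two ways round a parallelogram modulo the centre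
  have dr : ∀ x k l, d (x * ray l 1 0) k = d x k := by
    intro x k l
    by_cases hkl : HexVertex.proj N k = HexVertex.proj N l
    · rcases HexVertex.proj_eq_iff.1 hkl.symm with rfl | rfl
      · exact dray x l 1
      · rw [ray_add_half]
        exact dray x k (-1)
    · have h := congrArg β (congrArg (x * ·) (ray_mul_ray_comm k l 1 1 0 0))
      simp only [← mul_assoc, hc, hd, mul_one] at h
      have h' := congrArg (fun y : Heisenberg N => y.vec k) h
      simp [e_self, HexVertex.e_apply_of_proj_ne hkl] at h'
      exact h'.symm
  have dconst : ∀ x k, d x k = d 1 k := by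
    let H : Subgroup (Heisenberg N) :=
      { carrier := {v | ∀ x k, d (x * v) k = d x k}
        one_mem' := fun x k => by rw [mul_one]
        mul_mem' := fun {v w} hv hw x k => by rw [← mul_assoc, hw, hv]
        inv_mem' := fun {v} hv x k => by rw [← hv (x * v⁻¹), inv_mul_cancel_right] }
    have hH : H = ⊤ := eq_top_of_generators_mem H (fun s x k => dc x s k) fun l x k => by
      rw [← ray_one]
      exact dr x k l
    intro x k
    have : x ∈ H := hH ▸ Subgroup.mem_top _
    rw [← this 1 k, one_mul]
  -- the commutator of `(e_k, 0)` and `(e_{k+1}, 0)` is fixed but also multiplied by both signs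
  have dsucc : ∀ k, d 1 (k + 1) = d 1 k := by
    intro k
    have hray : ∀ l, β (ray l 1 0) = ray l (d 1 l) 0 := fun l => by
      have := hd 1 l 1
      rwa [one_mul, h1, one_mul, mul_one] at this
    have h := congrArg β (ray_mul_ray_comm k (k + 1) 1 1 0 0)
    rw [hc, hd, hd, dconst, dconst (ray _ _ _), hray, hray,
      ray_mul_ray_comm k (k + 1), mul_one, mul_one, mul_right_inj] at h
    have h' := congrArg cen h
    simp only [central_cen, one_mul] at h'
    have hB := form_e_succ_ne_zero hN k
    have h2 := hd0 1 k
    have h3 := hd0 1 (k + 1)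
    generalize form (e k) (e (k + 1)) = B at *
    generalize d 1 k = a at *
    generalize d 1 (k + 1) = b at *
    clear * - h' hB h2 h3
    revert a b B
    decide
  have dall : ∀ k, d 1 k = d 1 0 := by
    have : ∀ n : ℕ, d 1 (n : ZMod (2 * N)) = d 1 0 := by
      intro n
      induction n with
      | zero => rw [Nat.cast_zero]
      | succ n ih => rw [Nat.cast_succ, dsucc, ih]
    intro k
    rw [← ZMod.natCast_zmod_val k, this]
  refine ⟨d 1 0, dsq 1 0, ?_⟩
  let H : Subgroup (Heisenberg N) :=
    { carrier := {v | ∀ x, β (x * v) = β x * scale (d 1 0) (dsq 1 0) v}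
      one_mem' := fun x => by rw [mul_one, map_one, mul_one]
      mul_mem' := fun {v w} hv hw x => by rw [← mul_assoc, hw, hv, map_mul, mul_assoc]
      inv_mem' := fun {v} hv x => by
        rw [map_inv, eq_mul_inv_iff_mul_eq, ← hv, inv_mul_cancel_right] }
  have hH : H = ⊤ := by
    refine eq_top_of_generators_mem H (fun s x => ?_) fun k x => ?_
    · rw [hc]
      exact congrArg _ (Heisenberg.ext (smul_zero _).symm rfl)
    · rw [← ray_one, hd, dconst, dall, mul_one]
      exact congrArg _ (Heisenberg.ext (by simp [scale]) rfl)
  intro x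
  have : x ∈ H := hH ▸ Subgroup.mem_top _
  rw [← one_mul x, this 1, h1, one_mul, one_mul]

end Heisenberg

namespace HexVertex

open Antiperiodic Heisenberg

variable {N : ℕ} [NeZero N]

/-- The stabiliser of a vertex has order at most two. -/
theorem eq_one_or_eq_half_turn (hN : 2 ≤ N) (h3 : ¬ 3 ∣ N) (α : hexGraph N ≃g hexGraph N)
    (ho : α ⟨1, 0, true⟩ = ⟨1, 0, true⟩) :
    α = 1 ∨ α = toAut N ⟨1, r (N : ZMod (2 * N))⟩ := by
  obtain ⟨ε, hε, h⟩ := eq_scale hN (ptMap α 0) (congrArg pt ho)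
    (fun x s => ptMap_mul_central hN h3 ho x 0 s) fun x k => by
      obtain ⟨d, hd, h⟩ := (ptMap_hexagon hN h3 ho x k).1
      refine ⟨d, hd, fun t => ?_⟩
      rw [← ptMap_eq hN h3 ho _ (proj N k), h, ptMap_eq hN h3 ho]
  have hα : ∀ p, α p = ⟨scale ε hε p.pt, p.idx, p.up⟩ := by
    rintro ⟨x, i, b⟩
    cases b
    · rw [map_down_eq hN h3 ho, ptMap_eq hN h3 ho, h]
    · rw [map_up_eq hN h3 ho, ptMap_eq hN h3 ho, h]
  have hε' : ε = 1 ∨ ε = -1 := by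
    clear * - hε
    revert ε; decide
  rcases hε' with rfl | rfl
  · left
    refine RelIso.ext fun p => (hα p).trans ?_
    exact HexVertex.ext (Heisenberg.ext (one_smul _ _) rfl) rfl rfl
  · right
    refine RelIso.ext fun p => (hα p).trans ?_
    rw [toAut_apply, smul_r]
    refine HexVertex.ext ?_ (by rw [proj_half, add_zero]) rfl
    rw [one_mul]
    refine Heisenberg.ext ?_ (by simp [scale])
    rw [dihedral_smul_vec, half_turn_smul_vec]
    ext j
    simp [scale]

theorem toAut_surjective (hN : 2 ≤ N) (h3 : ¬ 3 ∣ N) : Function.Surjective (toAut N) := by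
  intro α
  obtain ⟨g, hg⟩ := exists_smul_eq (α ⟨1, 0, true⟩) (⟨1, 0, true⟩ : HexVertex N)
  rcases eq_one_or_eq_half_turn hN h3 (toAut N g * α) hg with h | h
  · refine ⟨g⁻¹, ?_⟩
    rw [map_inv, inv_eq_iff_mul_eq_one, h]
  · refine ⟨g⁻¹ * ⟨1, r (N : ZMod (2 * N))⟩, ?_⟩
    rw [map_mul, ← h, map_inv, inv_mul_cancel_left]

/-- The automorphism group of `hexGraph N`. -/
noncomputable def autEquiv (hN : 2 ≤ N) (h3 : ¬ 3 ∣ N) :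
    (hexGraph N ≃g hexGraph N) ≃* Heisenberg N ⋊[dihedralTwist N] DihedralGroup (2 * N) :=
  (MulEquiv.ofBijective (toAut N) ⟨toAut_injective, toAut_surjective hN h3⟩).symm

/-! ### Semiregular automorphisms -/

/-- The cube of any element over the half turn fixes a vertex. -/
theorem exists_half_turn_pow_three_smul_eq (v : Heisenberg N) :
    ∃ p : HexVertex N, (⟨v, r (N : ZMod (2 * N))⟩ ^ 3 :
      Heisenberg N ⋊[dihedralTwist N] DihedralGroup (2 * N)) • p = p := by
  -- the cube is `(v.vec, 0)` times the half turn, and `-v.vec` is half of `v.vec` over `𝔽₃`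
  refine ⟨⟨⟨-v.vec, 0⟩, 0, true⟩, ?_⟩
  have h3 : ∀ t : ZMod 3, t + t = -t := by decide
  have hs : ∀ x : HexVertex N, (⟨v, r (N : ZMod (2 * N))⟩ :
      Heisenberg N ⋊[dihedralTwist N] DihedralGroup (2 * N)) • x =
        ⟨⟨v.vec - x.pt.vec, v.cen + x.pt.cen - form v.vec x.pt.vec⟩, x.idx, x.up⟩ := by
    intro x
    rw [smul_r]
    refine HexVertex.ext (Heisenberg.ext ?_ ?_) (by rw [proj_half, add_zero]) rfl
    · rw [mul_vec, dihedral_smul_vec, half_turn_smul_vec, sub_eq_add_neg]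
    · rw [mul_cen, dihedral_smul_vec, half_turn_smul_vec, form_neg_right, dihedral_smul_cen,
        sign_r, one_mul]
      exact (sub_eq_add_neg _ _).symm
  have hv : v.vec - -v.vec = -v.vec := by
    ext j
    simp [sub_eq_add_neg, h3]
  rw [pow_succ, sq, mul_smul, mul_smul, hs, hs, hs]
  refine HexVertex.ext (Heisenberg.ext ?_ ?_) rfl rfl
  · simp only [hv]
  · simp only [hv, form_neg_right, form_self]
    generalize v.cen = t
    revert t; decide

/-- A dihedral element of order at least `4` is a rotation by `2 ^ a * b` with `b` odd and `a < m`;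
its power with exponent `2 ^ (m - a)` is the half turn. -/
theorem exists_pow_eq_half_turn {m : ℕ} (q : DihedralGroup (2 * 2 ^ m)) (hq : q ^ 2 ≠ 1) :
    ∃ n : ℕ, q ^ n = r ((2 ^ m : ℕ) : ZMod (2 * 2 ^ m)) := by
  rcases q with k | k
  · have hk : (r k : DihedralGroup (2 * 2 ^ m)) ^ 2 = r (2 * k) := by
      rw [sq, r_mul_r, ← two_mul k]
    rw [hk] at hq
    have hval : k.val ≠ 0 := by
      intro h
      rw [ZMod.val_eq_zero] at h
      exact hq (by rw [h, mul_zero, one_def])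
    obtain ⟨a, b, hb, hab⟩ := Nat.exists_eq_two_pow_mul_odd hval
    have ham : a < m := by
      by_contra! h
      obtain ⟨c, rfl⟩ := Nat.exists_eq_add_of_le h
      have h0 : ((2 * k.val : ℕ) : ZMod (2 * 2 ^ m)) = 0 := by
        rw [ZMod.natCast_eq_zero_iff, hab, pow_add, mul_assoc, ← mul_assoc]
        exact dvd_mul_right _ _
      push_cast at h0
      rw [ZMod.natCast_zmod_val] at h0
      exact hq (by rw [h0, one_def])
    obtain ⟨c, hc⟩ := hb
    refine ⟨2 ^ (m - a), ?_⟩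
    rw [r_pow]
    congr 1
    have h1 : k.val * 2 ^ (m - a) = 2 * 2 ^ m * c + 2 ^ m := by
      have : 2 ^ a * 2 ^ (m - a) = 2 ^ m := by rw [← pow_add, Nat.add_sub_cancel' ham.le]
      rw [hab, mul_right_comm, this, hc]
      ring
    rw [← ZMod.natCast_zmod_val k, ← Nat.cast_mul, h1, Nat.cast_add, Nat.cast_mul,
      ZMod.natCast_self, zero_mul, zero_add]
  · exact absurd (by rw [sq, sr_mul_sr, sub_self, one_def]) hq

theorem pow_six_eq_one {m : ℕ} {g : Heisenberg (2 ^ m) ⋊[dihedralTwist (2 ^ m)]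
    DihedralGroup (2 * 2 ^ m)} (hg : SimpleGraph.IsSemiregularAut (toAut (2 ^ m) g)) :
    g ^ 6 = 1 := by
  have hright : ∀ n : ℕ, (g ^ n).right = g.right ^ n := fun n =>
    map_pow SemidirectProduct.rightHom g n
  by_cases hq : g.right ^ 2 = 1
  · have h2 : g ^ 2 = SemidirectProduct.inl (g ^ 2).left :=
      SemidirectProduct.ext rfl (by rw [hright, hq, SemidirectProduct.right_inl])
    rw [show 6 = 2 * 3 from rfl, pow_mul, h2, ← map_pow, Heisenberg.pow_three, map_one]
  · exfalso
    obtain ⟨n, hn⟩ := exists_pow_eq_half_turn g.right hq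
    have hgn : g ^ n = ⟨(g ^ n).left, r ((2 ^ m : ℕ) : ZMod (2 * 2 ^ m))⟩ :=
      SemidirectProduct.ext rfl ((hright n).trans hn)
    obtain ⟨p, hp⟩ := exists_half_turn_pow_three_smul_eq (g ^ n).left
    rw [← hgn, ← pow_mul] at hp
    have h1 := hg (toAut (2 ^ m) g ^ (n * 3)) (Subgroup.npow_mem_zpowers _ _)
      ⟨p, by rw [← map_pow]; exact hp⟩
    rw [← map_pow, map_eq_one_iff _ toAut_injective] at h1
    have h2 := hright (n * 3)
    rw [h1, pow_mul, hn, SemidirectProduct.one_right, r_pow, one_def] at h2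
    have h3 := r.inj h2
    have h4 : ((2 ^ m : ℕ) : ZMod (2 * 2 ^ m)) * (3 : ℕ) =
        ((2 ^ m : ℕ) : ZMod (2 * 2 ^ m)) + (2 ^ m : ℕ) + (2 ^ m : ℕ) := by
      push_cast; ring
    rw [h4, half_add_half, zero_add] at h3
    exact half_ne_zero h3.symm

end HexVertex

/-! ### The theorem -/

open HexVertex Heisenberg in
theorem exists_cubic_graph (m : ℕ) (hm : 1 ≤ m) :
      ∃ (Ω : Type) (_ : Finite Ω) (Γ : SimpleGraph Ω),
        Nat.card Ω = 2 ^ (m + 1) * 3 ^ (2 ^ m + 1) ∧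
        Γ.IsCubicVertexTransitive ∧
        (∃ (V : Type) (_ : Group V) (φ : DihedralGroup (2 ^ (m + 1)) →* MulAut V),
          IsExtraspecialGroup 3 V ∧
          Nat.card V = 3 ^ (2 ^ m + 1) ∧
          Monoid.exponent V = 3 ∧
          Nonempty ((Γ ≃g Γ) ≃* SemidirectProduct V (DihedralGroup (2 ^ (m + 1))) φ)) ∧
        (∀ g : Γ ≃g Γ, SimpleGraph.IsSemiregularAut g →
          orderOf g = 1 ∨ orderOf g = 2 ∨ orderOf g = 3 ∨ orderOf g = 6) := by
  have hpow : 2 ^ (m + 1) = 2 * 2 ^ m := pow_succ' 2 m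
  have hN : 2 ≤ 2 ^ m := Nat.pow_le_pow_right (n := 2) (by norm_num) hm |>.trans' (by norm_num)
  have heven : Even (2 ^ m) := (Nat.even_pow).2 ⟨even_two, by omega⟩
  have h3 : ¬ 3 ∣ 2 ^ m := fun h => absurd (Nat.prime_three.dvd_of_dvd_pow h) (by norm_num)
  rw [hpow]
  refine ⟨HexVertex (2 ^ m), inferInstance, hexGraph (2 ^ m), HexVertex.natCard,
    isCubicVertexTransitive h3, ⟨Heisenberg (2 ^ m), inferInstance, dihedralTwist (2 ^ m),
      isExtraspecialGroup heven, Heisenberg.natCard, exponent_eq_three, ⟨autEquiv hN h3⟩⟩, ?_⟩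
  intro α hα
  obtain ⟨g, rfl⟩ := toAut_surjective hN h3 α
  have h6 : orderOf (toAut (2 ^ m) g) ∣ 6 := by
    rw [orderOf_dvd_iff_pow_eq_one, ← map_pow, pow_six_eq_one hα, map_one]
  have hle := Nat.le_of_dvd (by norm_num) h6
  generalize orderOf (toAut (2 ^ m) g) = n at h6 hle
  interval_cases n <;> omega

theorem theorem1p2 :
    (¬ ∃ f : ℕ → ℕ, Tendsto f atTop atTop ∧
        ∀ (Ω : Type) [Finite Ω] (Γ : SimpleGraph Ω), Γ.IsCubicVertexTransitive →
          ∃ g : Γ ≃g Γ, SimpleGraph.IsSemiregularAut g ∧ f (Nat.card Ω) ≤ orderOf g) ∧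
    (∀ m : ℕ, 1 ≤ m →
      ∃ (Ω : Type) (_ : Finite Ω) (Γ : SimpleGraph Ω),
        Nat.card Ω = 2 ^ (m + 1) * 3 ^ (2 ^ m + 1) ∧
        Γ.IsCubicVertexTransitive ∧
        (∃ (V : Type) (_ : Group V) (φ : DihedralGroup (2 ^ (m + 1)) →* MulAut V),
          IsExtraspecialGroup 3 V ∧
          Nat.card V = 3 ^ (2 ^ m + 1) ∧
          Monoid.exponent V = 3 ∧
          Nonempty ((Γ ≃g Γ) ≃* SemidirectProduct V (DihedralGroup (2 ^ (m + 1))) φ)) ∧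
        (∀ g : Γ ≃g Γ, SimpleGraph.IsSemiregularAut g →
          orderOf g = 1 ∨ orderOf g = 2 ∨ orderOf g = 3 ∨ orderOf g = 6)) := by
  refine ⟨?_, exists_cubic_graph⟩
  rintro ⟨f, hf, h⟩
  obtain ⟨n, hn⟩ := Filter.eventually_atTop.1 (hf.eventually_ge_atTop 7)
  obtain ⟨Ω, _, Γ, hcard, hΓ, -, hord⟩ := exists_cubic_graph (n + 1) (by omega)
  have hle : n ≤ Nat.card Ω := by
    rw [hcard]
    calc n ≤ n + 1 + 1 := by omega
      _ ≤ 2 ^ (n + 1 + 1) := Nat.lt_two_pow_self.le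
      _ ≤ _ := Nat.le_mul_of_pos_right _ (by positivity)
  obtain ⟨g, hg, hg'⟩ := h Ω Γ hΓ
  have := (hn _ hle).trans hg'
  rcases hord g hg with h | h | h | h <;> omega
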